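/- **Setting.** Let $\mathcal S$ be the class of small categories $\mathcal C$ satisfying the following two conditions. (A) For every morphism $f:i\to j$ and every monomorphism $\alpha:k\to j$ of $\mathcal C$ the pullback of $f$ and $\alpha$ exists. (B) For all monomorphisms $\alpha:i\to j$ and $\beta:j\to k$ there are an object $l$ and monomorphisms $\gamma:i\to l$, $\delta:l\to k$ such that $\beta\alpha=\delta\gamma$ is a pullback square (of $\beta$ and $\delta$), and such that for all monomorphisms $\xi:m\to i$, $\eta:m\to n$, $\zeta:n\to k$ for which $\beta(\alpha\xi)=\zeta\eta$ is a pullback square (of $\beta$ and $\zeta$) there is $\varphi:n\to l$ with $\varphi\eta=\gamma\xi$ and $\delta\varphi=\zeta$. For a category $\mathcal C$ satisfying (A), the partialization $\mathcal P(\mathcal C)$ has the same objects as $\mathcal C$; its morphisms $i\to j$ are the classes $[\alpha,f]$ of diagrams $i\xleftarrow{\alpha}k\xrightarrow{f}j$ with $\alpha$ a monomorphism, where $(\alpha,f)\sim(\alpha',f')$ if $\alpha'\gamma=\alpha$ and $f'\gamma=f$ for some isomorphism $\gamma$; and $[\beta,g]\circ[\alpha,f]=[\alpha a,gb]$, where $fa=\beta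 b$ is a pullback square. Let $\iota:\mathcal C\to\mathcal P(\mathcal C)$, $f\mapsto[1,f]$, be the canonical inclusion. It preserves monomorphisms. Let $\mathcal C\in\mathcal S$ be such that all morphisms of $\mathcal C$ are monomorphisms. Then the iterated partializations $\mathcal P^0(\mathcal C)=\mathcal C$, $\mathcal P^{n+1}(\mathcal C)=\mathcal P(\mathcal P^n(\mathcal C))$ are defined for all $n\ge 0$. For a chain of monomorphisms $i\xleftarrow{\alpha_n}k_n\xleftarrow{\alpha_{n-1}}\cdots\xleftarrow{\alpha_1}k_1$ in $\mathcal C$ and a morphism $f:k_1\to j$ let $\mathrm D(n,i,j,k_\bullet,\alpha_\bullet,f):i\to j$ be the morphism of $\mathcal P^n(\mathcal C)$ defined by $\mathrm D(0,i,j,f)=f$ (here $k_1=i$) and $\mathrm D(n,i,j,k_\bullet,\alpha_\bullet,f)=[\iota^{n-1}(\alpha_n),\,\mathrm D(n-1,k_n,j,(k_s)_{s<n},(\alpha_s)_{s<n},f)]$ for $n\ge1$. Every morphism of $\mathcal P^n(\mathcal C)$ is of this form. **Theorem.** Let $\mathcal C\in\mathcal S$ be such that all morphisms of $\mathcal C$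 are monomorphisms. (i) Let $n\ge0$, $x=\mathrm D(n,i,j,k_\bullet,\alpha_\bullet,f)$ and $y=\mathrm D(n,j,i,l_\bullet,\beta_\bullet,g)$. Then $x$ and $y$ form a pair of inverse elements (that is, $xyx=x$ and $yxy=y$ in $\mathcal P^n(\mathcal C)$) if and only if there is an isomorphism $\gamma:k_1\to l_1$ such that $\alpha_n\cdots\alpha_2\alpha_1=g\gamma$ and $f=\beta_n\cdots\beta_2\beta_1\gamma$. (For $n=0$ the empty composites are identities.) (ii) For each $k\ge1$ and each object $i$ of $\mathcal C$ the monoid $\mathrm{End}_{\mathcal P^k(\mathcal C)}(i)$ is regular (every $x$ has some $y$ with $xyx=x$), and it is a retract of the monoid $\mathrm{End}_{\mathcal P^{k+1}(\mathcal C)}(i)$ (there are monoid homomorphisms $\mathrm{End}_{\mathcal P^k(\mathcal C)}(i)\to\mathrm{End}_{\mathcal P^{k+1}(\mathcal C)}(i)\to\mathrm{End}_{\mathcal P^k(\mathcal C)}(i)$ whose composite is the identity). (iii) Let $n\ge0$. The element $\mathrm D(n,i,i,k_\bullet,\alpha_\bullet,f)$ is an idempotent if and only if $f=\alpha_n\cdots\alpha_2\alpha_1$.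 (iv) For each $k\ge1$ and each object $i$ of $\mathcal C$ the monoid $\mathrm{End}_{\mathcal P^k(\mathcal C)}(i)$ is orthodox, i.e. it is regular and its idempotents form a subsemigroup. -/

import Mathlib

universe u

open CategoryTheory CategoryTheory.Limits

namespace Partialize

/-! ### The two conditions on a small category -/

/-- Pullbacks along monomorphisms exist: for every `f : i ⟶ j` and every monomorphism
`α : k ⟶ j` there is a pullback of `f` and `α`. -/
class HasMonoPullbacks (C : Type u) [SmallCategory C] : Prop where
  hasPullback : ∀ {i j k : C} (f : i ⟶ j) (α : k ⟶ j) [Mono α], HasPullback f α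

/-- Complement diagrams exist: for monomorphisms `α : i ⟶ j` and `β : j ⟶ k` there are
monomorphisms `γ : i ⟶ l` and `δ : l ⟶ k` such that the square `α ≫ β = γ ≫ δ` is a pullback,
and for all monomorphisms `ξ : m ⟶ i`, `η : m ⟶ n`, `ζ : n ⟶ k` such that the square
`(ξ ≫ α) ≫ β = η ≫ ζ` is a pullback there is `φ : n ⟶ l` making the whole diagram commute. -/
class HasComplements (C : Type u) [SmallCategory C] : Prop where
  exists_complement : ∀ {i j k : C} (α : i ⟶ j) (β : j ⟶ k) [Mono α] [Mono β],
    ∃ (l : C) (γ : i ⟶ l) (δ : l ⟶ k), Mono γ ∧ Mono δ ∧ IsPullback α γ β δ ∧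
      ∀ {m n : C} (ξ : m ⟶ i) (η : m ⟶ n) (ζ : n ⟶ k) [Mono ξ] [Mono η] [Mono ζ],
        IsPullback (ξ ≫ α) η β ζ → ∃ φ : n ⟶ l, η ≫ φ = ξ ≫ γ ∧ φ ≫ δ = ζ

/-- Membership in the class `𝒮`: small categories satisfying both conditions. -/
class InS (C : Type u) [SmallCategory C] : Prop extends HasMonoPullbacks C, HasComplements C

/-- All morphisms are monomorphisms. -/
class AllMono (C : Type u) [SmallCategory C] : Prop where
  mono : ∀ {i j : C} (f : i ⟶ j), Mono f

/-- The complement condition with the universal property tested on *all* morphisms. It agrees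
with `HasComplements` if all morphisms are monic (`AllMono.hasStrongComplements`), and unlike
that condition it is visibly inherited by the partialization. It is only used to know that
the iterated partializations below exist; it is never assumed. -/
class HasStrongComplements (C : Type u) [SmallCategory C] : Prop where
  exists_complement : ∀ {i j k : C} (α : i ⟶ j) (β : j ⟶ k) [Mono α] [Mono β],
    ∃ (l : C) (γ : i ⟶ l) (δ : l ⟶ k), Mono γ ∧ Mono δ ∧ IsPullback α γ β δ ∧
      ∀ {m n : C} (ξ : m ⟶ i) (η : m ⟶ n) (ζ : n ⟶ k),
        IsPullback (ξ ≫ α) η β ζ → ∃ φ : n ⟶ l, η ≫ φ = ξ ≫ γ ∧ φ ≫ δ = ζ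

theorem AllMono.hasStrongComplements (C : Type u) [SmallCategory C] [HasComplements C]
    [AllMono C] : HasStrongComplements C where
  exists_complement α β _ _ := by
    obtain ⟨l, γ, δ, hγ, hδ, hp, h⟩ := HasComplements.exists_complement α β
    refine ⟨l, γ, δ, hγ, hδ, hp, fun ξ η ζ hpb => ?_⟩
    have := AllMono.mono ξ
    have := AllMono.mono η
    have := AllMono.mono ζ
    exact h ξ η ζ hpb

/-! ### The partialization of a category -/

section Partialization

variable {C : Type u} [SmallCategory C]

/-- A diagram `i ↩ k ⟶ j` whose left leg is a monomorphism. -/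
structure Diag (i j : C) : Type u where
  dom : C
  incl : dom ⟶ i
  mono : Mono incl
  map : dom ⟶ j

/-- Two diagrams are equivalent if an isomorphism of their middle objects commutes with both
legs. -/
instance Diag.setoid (i j : C) : Setoid (Diag i j) where
  r x y := ∃ e : x.dom ≅ y.dom, e.hom ≫ y.incl = x.incl ∧ e.hom ≫ y.map = x.map
  iseqv :=
    { refl := fun x => ⟨Iso.refl _, by simp, by simp⟩
      symm := fun {x y} ⟨e, h1, h2⟩ => ⟨e.symm, by simp [← h1], by simp [← h2]⟩
      trans := fun {x y z} ⟨e, h1, h2⟩ ⟨e', h1', h2'⟩ =>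
        ⟨e.trans e', by simp [h1', h1], by simp [h2', h2]⟩ }

/-- The morphisms of the partialization: equivalence classes of diagrams. -/
def PHom (i j : C) : Type u := Quotient (Diag.setoid i j)

/-- The class of the diagram `i ↩ k ⟶ j`. -/
def PHom.mk {i j k : C} (α : k ⟶ i) [h : Mono α] (f : k ⟶ j) : PHom i j :=
  Quotient.mk _ ⟨k, α, h, f⟩

theorem PHom.mk_eq_iff {i j k k' : C} (α : k ⟶ i) [Mono α] (f : k ⟶ j) (α' : k' ⟶ i) [Mono α']
    (f' : k' ⟶ j) :
    PHom.mk α f = PHom.mk α' f' ↔ ∃ e : k ≅ k', e.hom ≫ α' = α ∧ e.hom ≫ f' = f :=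
  Quotient.eq (r := Diag.setoid i j)

theorem PHom.exists_rep {i j : C} (x : PHom i j) :
    ∃ (k : C) (α : k ⟶ i) (_ : Mono α) (f : k ⟶ j), x = PHom.mk α f := by
  induction x using Quotient.inductionOn with
  | h d => exact ⟨d.dom, d.incl, d.mono, d.map, rfl⟩

variable [HasMonoPullbacks C]

theorem exists_isPullback {i j k : C} (f : i ⟶ j) (α : k ⟶ j) [Mono α] :
    ∃ (p : C) (a : p ⟶ i) (b : p ⟶ k), Mono a ∧ IsPullback a b f α := by
  have := HasMonoPullbacks.hasPullback f α
  exact ⟨_, pullback.fst f α, pullback.snd f α, inferInstance, IsPullback.of_hasPullback f α⟩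

/-- Composition of diagrams (`x` first, then `y`), through the pullback of the right leg of `x`
along the left leg of `y`. -/
noncomputable def Diag.comp {i j m : C} (x : Diag i j) (y : Diag j m) : Diag i m :=
  have := x.mono
  have := y.mono
  haveI := HasMonoPullbacks.hasPullback x.map y.incl
  { dom := pullback x.map y.incl
    incl := pullback.fst x.map y.incl ≫ x.incl
    mono := mono_comp _ _
    map := pullback.snd x.map y.incl ≫ y.map }

/-- The composition of diagrams may be computed with any pullback. -/
theorem Diag.comp_equiv {i j m : C} (x : Diag i j) (y : Diag j m) {p : C} {a : p ⟶ x.dom}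
    {b : p ⟶ y.dom} (h : IsPullback a b x.map y.incl) (hm : Mono (a ≫ x.incl)) :
    (⟨p, a ≫ x.incl, hm, b ≫ y.map⟩ : Diag i m) ≈ x.comp y := by
  have := x.mono
  have := y.mono
  have := HasMonoPullbacks.hasPullback x.map y.incl
  refine ⟨h.isoIsPullback _ _ (IsPullback.of_hasPullback x.map y.incl), ?_, ?_⟩ <;>
    simp [Diag.comp]

/-- Composition in the partialization (`x` first, then `y`). -/
noncomputable def PHom.comp {i j m : C} (x : PHom i j) (y : PHom j m) : PHom i m :=
  Quotient.map₂ Diag.comp (by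
    rintro x x' ⟨e, h1, h2⟩ y y' ⟨e', h1', h2'⟩
    have := x.mono
    have := y.mono
    have := x'.mono
    have := y'.mono
    have := HasMonoPullbacks.hasPullback x.map y.incl
    have hp := IsPullback.of_hasPullback x.map y.incl
    have hp' : IsPullback (pullback.fst x.map y.incl ≫ e.hom)
        (pullback.snd x.map y.incl ≫ e'.hom) x'.map y'.incl :=
      hp.of_iso (Iso.refl _) e e' (Iso.refl _) (by simp) (by simp) (by simp [h2]) (by simp [h1'])
    have : Mono ((pullback.fst x.map y.incl ≫ e.hom) ≫ x'.incl) := mono_comp _ _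
    have := Diag.comp_equiv x' y' hp' this
    refine Setoid.trans ?_ this
    exact ⟨Iso.refl _, by simp [Diag.comp, h1], by simp [Diag.comp, h2']⟩) x y

theorem PHom.mk_comp_mk {i j m k l p : C} (α : k ⟶ i) [Mono α] (f : k ⟶ j) (β : l ⟶ j) [Mono β]
    (g : l ⟶ m) {a : p ⟶ k} {b : p ⟶ l} [Mono a] (h : IsPullback a b f β) :
    (PHom.mk α f).comp (PHom.mk β g) = PHom.mk (a ≫ α) (b ≫ g) :=
  (Quotient.sound (Diag.comp_equiv ⟨k, α, inferInstance, f⟩ ⟨l, β, inferInstance, g⟩ h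
    (mono_comp _ _))).symm

/-- Partial morphism followed by a total one. -/
theorem PHom.mk_comp_total {i j m k : C} (α : k ⟶ i) [Mono α] (f : k ⟶ j) (g : j ⟶ m) :
    (PHom.mk α f).comp (PHom.mk (𝟙 j) g) = PHom.mk α (f ≫ g) := by
  rw [PHom.mk_comp_mk α f (𝟙 j) g (IsPullback.of_id_fst (f := f))]
  simp

theorem PHom.total_comp_mk {i j m l p : C} (f : i ⟶ j) (β : l ⟶ j) [Mono β]
    (g : l ⟶ m) {a : p ⟶ i} {b : p ⟶ l} [Mono a] (h : IsPullback a b f β) :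
    (PHom.mk (𝟙 i) f).comp (PHom.mk β g) = PHom.mk a (b ≫ g) := by
  rw [PHom.mk_comp_mk (𝟙 i) f β g h, PHom.mk_eq_iff]
  exact ⟨Iso.refl _, by simp, by simp⟩

theorem PHom.id_comp {i j : C} (x : PHom i j) : (PHom.mk (𝟙 i) (𝟙 i)).comp x = x := by
  obtain ⟨k, α, hα, f, rfl⟩ := PHom.exists_rep x
  rw [PHom.total_comp_mk (𝟙 i) α f (a := α) (b := 𝟙 _) IsPullback.of_id_snd]
  simp

theorem PHom.comp_id {i j : C} (x : PHom i j) : x.comp (PHom.mk (𝟙 j) (𝟙 j)) = x := by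
  obtain ⟨k, α, hα, f, rfl⟩ := PHom.exists_rep x
  rw [PHom.mk_comp_total]
  simp

theorem PHom.assoc {i j l m : C} (x : PHom i j) (y : PHom j l) (z : PHom l m) :
    (x.comp y).comp z = x.comp (y.comp z) := by
  obtain ⟨k₁, α, hα, f, rfl⟩ := PHom.exists_rep x
  obtain ⟨k₂, β, hβ, g, rfl⟩ := PHom.exists_rep y
  obtain ⟨k₃, γ, hγ, h, rfl⟩ := PHom.exists_rep z
  obtain ⟨p, a, b, ha, hp⟩ := exists_isPullback f β
  obtain ⟨q, c, d, hc, hq⟩ := exists_isPullback g γ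
  obtain ⟨t, r, s, hr, ht⟩ := exists_isPullback b c
  have : Mono (a ≫ α) := mono_comp _ _
  have : Mono (c ≫ β) := mono_comp _ _
  have : Mono (r ≫ a) := mono_comp _ _
  rw [PHom.mk_comp_mk α f β g hp, PHom.mk_comp_mk β g γ h hq,
    PHom.mk_comp_mk (a ≫ α) (b ≫ g) γ h (ht.paste_vert hq),
    PHom.mk_comp_mk α f (c ≫ β) (d ≫ h) (ht.paste_horiz hp)]
  simp

/-- The partialization of `C`: its objects are (copies of) the objects of `C`, its morphisms are
the equivalence classes of diagrams. -/
structure P (C : Type u) : Type u where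
  of ::
  as : C

noncomputable instance P.category : SmallCategory (P C) where
  Hom i j := PHom i.as j.as
  id i := PHom.mk (𝟙 i.as) (𝟙 i.as)
  comp x y := PHom.comp x y
  id_comp x := PHom.id_comp x
  comp_id x := PHom.comp_id x
  assoc x y z := PHom.assoc x y z

/-- The class of the diagram `i ↩ k ⟶ j`, as a morphism of the partialization. -/
def P.mk {i j k : C} (α : k ⟶ i) [Mono α] (f : k ⟶ j) : P.of i ⟶ P.of j := PHom.mk α f

/-- The canonical inclusion of `C` into its partialization. -/
def P.ι {i j : C} (f : i ⟶ j) : P.of i ⟶ P.of j := P.mk (𝟙 i) f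

theorem P.mk_eq_iff {i j k k' : C} (α : k ⟶ i) [Mono α] (f : k ⟶ j) (α' : k' ⟶ i) [Mono α']
    (f' : k' ⟶ j) :
    P.mk α f = P.mk α' f' ↔ ∃ e : k ≅ k', e.hom ≫ α' = α ∧ e.hom ≫ f' = f :=
  PHom.mk_eq_iff α f α' f'

theorem P.exists_rep {i j : C} (x : P.of i ⟶ P.of j) :
    ∃ (k : C) (α : k ⟶ i) (_ : Mono α) (f : k ⟶ j), x = P.mk α f :=
  PHom.exists_rep x

theorem P.mk_comp_mk {i j m k l p : C} (α : k ⟶ i) [Mono α] (f : k ⟶ j) (β : l ⟶ j) [Mono β]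
    (g : l ⟶ m) {a : p ⟶ k} {b : p ⟶ l} [Mono a] [Mono (a ≫ α)] (h : IsPullback a b f β) :
    P.mk α f ≫ P.mk β g = P.mk (a ≫ α) (b ≫ g) :=
  PHom.mk_comp_mk α f β g h

theorem P.mk_comp_ι {i j m k : C} (α : k ⟶ i) [Mono α] (f : k ⟶ j) (g : j ⟶ m) :
    P.mk α f ≫ P.ι g = P.mk α (f ≫ g) :=
  PHom.mk_comp_total α f g

theorem P.ι_comp_mk {i j m l p : C} (f : i ⟶ j) (β : l ⟶ j) [Mono β]
    (g : l ⟶ m) {a : p ⟶ i} {b : p ⟶ l} [Mono a] (h : IsPullback a b f β) :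
    P.ι f ≫ P.mk β g = P.mk a (b ≫ g) :=
  PHom.total_comp_mk f β g h

theorem P.ι_comp {i j m : C} (f : i ⟶ j) (g : j ⟶ m) : P.ι f ≫ P.ι g = P.ι (f ≫ g) :=
  P.mk_comp_ι (𝟙 i) f g

theorem P.ι_id (i : C) : P.ι (𝟙 i) = 𝟙 (P.of i) := rfl

theorem P.ι_injective {i j : C} {f g : i ⟶ j} (h : P.ι f = P.ι g) : f = g := by
  obtain ⟨e, h1, h2⟩ := (P.mk_eq_iff (𝟙 i) f (𝟙 i) g).1 h
  have : e.hom = 𝟙 i := by simpa using h1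
  simpa [this] using h2.symm

instance P.mono_ι {i j : C} (f : i ⟶ j) [Mono f] : Mono (P.ι f) where
  right_cancellation := fun {k} x y h => by
    obtain ⟨k⟩ := k
    obtain ⟨l, α, hα, g, rfl⟩ := P.exists_rep x
    obtain ⟨l', α', hα', g', rfl⟩ := P.exists_rep y
    rw [P.mk_comp_ι, P.mk_comp_ι] at h
    obtain ⟨e, h1, h2⟩ := (P.mk_eq_iff _ _ _ _).1 h
    refine (P.mk_eq_iff _ _ _ _).2 ⟨e, h1, ?_⟩
    rwa [← Category.assoc, cancel_mono] at h2

/-- The monomorphisms of the partialization are the monomorphisms of `C`. -/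
theorem P.exists_eq_ι_of_mono {i j : C} (x : P.of i ⟶ P.of j) [Mono x] :
    ∃ (f : i ⟶ j) (_ : Mono f), x = P.ι f := by
  obtain ⟨k, α, hα, f, rfl⟩ := P.exists_rep x
  have h1 : P.mk α α ≫ P.mk α f = 𝟙 (P.of i) ≫ P.mk α f := by
    have hp : IsPullback (𝟙 k) (𝟙 k) α α := ⟨⟨rfl⟩, ⟨PullbackCone.isLimitMkIdId α⟩⟩
    have : Mono (𝟙 k ≫ α) := by simpa using hα
    rw [P.mk_comp_mk α α α f hp, Category.id_comp (P.mk α f)]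
    exact (P.mk_eq_iff _ _ _ _).2 ⟨Iso.refl _, by simp, by simp⟩
  rw [cancel_mono] at h1
  obtain ⟨e, h2, -⟩ := (P.mk_eq_iff α α (𝟙 i) (𝟙 i)).1 h1
  have hiso : IsIso α := by
    have : α = e.hom := by simpa using h2.symm
    rw [this]; infer_instance
  have hx : P.mk α f = P.ι (inv α ≫ f) :=
    (P.mk_eq_iff _ _ _ _).2 ⟨asIso α, by simp, by simp⟩
  refine ⟨inv α ≫ f, ⟨fun {l} g h hgh => P.ι_injective ?_⟩, hx⟩
  have := congrArg P.ι hgh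
  rwa [← P.ι_comp g, ← P.ι_comp h, ← hx, cancel_mono] at this

/-- A criterion for a commutative square with two monic legs to be a pullback. -/
theorem isPullback_of_mono {D : Type u} [SmallCategory D] {p i l j : D} {a : p ⟶ i} {b : p ⟶ l}
    {f : i ⟶ j} {g : l ⟶ j} [Mono a] [Mono g] (w : a ≫ f = b ≫ g)
    (h : ∀ {q : D} (u : q ⟶ i) (z : q ⟶ l), u ≫ f = z ≫ g → ∃ v : q ⟶ p, v ≫ a = u) :
    IsPullback a b f g := by
  have h' : ∀ s : PullbackCone f g, ∃ v : s.pt ⟶ p, v ≫ a = s.fst :=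
    fun s => h s.fst s.snd s.condition
  choose v hv using h'
  refine ⟨⟨w⟩, ⟨PullbackCone.IsLimit.mk w v hv (fun s => ?_) (fun s m h1 _ => ?_)⟩⟩
  · rw [← cancel_mono g, Category.assoc, ← w, ← Category.assoc, hv, s.condition]
  · rw [← cancel_mono a, h1, hv]

/-- Under the strong complement condition, the partialization again has pullbacks along
monomorphisms. -/
instance P.hasMonoPullbacks [HasStrongComplements C] : HasMonoPullbacks (P C) where
  hasPullback := by
    rintro ⟨i⟩ ⟨j⟩ ⟨l⟩ x b _
    obtain ⟨β, hβ, rfl⟩ := P.exists_eq_ι_of_mono b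
    obtain ⟨k, α, hα, f, rfl⟩ := P.exists_rep x
    obtain ⟨m, β', f', hβ', hp⟩ := exists_isPullback (C := C) f β
    obtain ⟨n, α', β'', hα', hβ'', hq, huniv⟩ :=
      HasStrongComplements.exists_complement (C := C) β' α
    have hsq : P.ι β'' ≫ P.mk α f = P.mk α' f' ≫ P.ι β := by
      rw [P.ι_comp_mk β'' α f hq.flip, P.mk_comp_ι, hp.w]
    have key : IsPullback (P.ι β'') (P.mk α' f') (P.mk α f) (P.ι β) := by
      refine isPullback_of_mono hsq fun {q} u z h => ?_
      obtain ⟨q⟩ := q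
      obtain ⟨r, ξ, hξ, v, rfl⟩ := P.exists_rep u
      obtain ⟨t, ζ, hζ, w, rfl⟩ := P.exists_rep z
      obtain ⟨s, s₁, s₂, hs₁, hs⟩ := exists_isPullback (C := C) v α
      have : Mono (s₁ ≫ ξ) := mono_comp _ _
      rw [P.mk_comp_mk ξ v α f hs, P.mk_comp_ι] at h
      obtain ⟨e, -, h2⟩ := (P.mk_eq_iff _ _ _ _).1 h
      have h3 : s₂ ≫ f = (e.hom ≫ w) ≫ β := by rw [Category.assoc, h2]
      have hlift : hp.lift s₂ (e.hom ≫ w) h3 ≫ β' = s₂ := hp.lift_fst _ _ _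
      obtain ⟨φ, -, hφ⟩ := huniv (hp.lift s₂ (e.hom ≫ w) h3) s₁ v (by
        rw [hlift]; exact hs.flip)
      refine ⟨P.mk ξ φ, ?_⟩
      have := P.mk_comp_ι ξ φ β''
      rw [hφ] at this
      exact this
    exact key.hasPullback

/-- The partialization inherits the strong complement condition. -/
instance P.hasStrongComplements [HasStrongComplements C] : HasStrongComplements (P C) where
  exists_complement := by
    rintro ⟨i⟩ ⟨j⟩ ⟨k⟩ a b _ _
    obtain ⟨α, hα, rfl⟩ := P.exists_eq_ι_of_mono a
    obtain ⟨β, hβ, rfl⟩ := P.exists_eq_ι_of_mono b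
    obtain ⟨l, γ, δ, hγ, hδ, hp, huniv⟩ :=
      HasStrongComplements.exists_complement (C := C) α β
    have hsq : P.ι α ≫ P.ι β = P.ι γ ≫ P.ι δ := by
      rw [P.ι_comp, P.ι_comp, hp.w]
    refine ⟨P.of l, P.ι γ, P.ι δ, inferInstance, inferInstance, ?_, ?_⟩
    · refine isPullback_of_mono hsq fun {q} u z h => ?_
      obtain ⟨q⟩ := q
      obtain ⟨r, ξ, hξ, v, rfl⟩ := P.exists_rep u
      obtain ⟨t, ζ, hζ, w, rfl⟩ := P.exists_rep z
      rw [P.mk_comp_ι, P.mk_comp_ι] at h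
      obtain ⟨e, -, h2⟩ := (P.mk_eq_iff _ _ _ _).1 h
      have h3 : v ≫ β = (e.hom ≫ w) ≫ δ := by rw [Category.assoc, h2]
      refine ⟨P.mk ξ (hp.lift v (e.hom ≫ w) h3), ?_⟩
      have := P.mk_comp_ι ξ (hp.lift v (e.hom ≫ w) h3) α
      rw [hp.lift_fst] at this
      exact this
    · rintro ⟨m⟩ ⟨n⟩ x y z hpb
      obtain ⟨n', ν, hν, ζ, rfl⟩ := P.exists_rep z
      obtain ⟨m₀, s, r, hs, hm₀⟩ := exists_isPullback (C := C) ζ β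
      have : Mono (s ≫ ν) := mono_comp _ _
      have h1 : P.ι r ≫ P.ι β = P.ι (s ≫ ν) ≫ P.mk ν ζ := by
        have hν' : IsPullback (𝟙 m₀) s (s ≫ ν) ν :=
          isPullback_of_mono (by simp) fun u _ _ => ⟨u, Category.comp_id u⟩
        rw [P.ι_comp_mk (s ≫ ν) ν ζ hν', P.ι_comp, ← hm₀.w]
        rfl
      obtain ⟨w, hw⟩ : ∃ w : P.of m₀ ⟶ P.of m, (w ≫ x) ≫ P.ι α = P.ι r :=
        ⟨hpb.lift _ _ h1, by rw [Category.assoc, hpb.lift_fst]⟩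
      obtain ⟨t, ρ, hρ, ξ, hwx⟩ := P.exists_rep (w ≫ x)
      have h2 : P.mk ρ (ξ ≫ α) = P.mk (𝟙 m₀) r := by
        rw [← P.mk_comp_ι, ← hwx]
        exact hw
      obtain ⟨e, -, h3⟩ := (P.mk_eq_iff _ _ _ _).1 h2
      have h4 : (e.inv ≫ ξ) ≫ α = r := by rw [Category.assoc, ← h3]; simp
      obtain ⟨φ, -, hφ⟩ := huniv (e.inv ≫ ξ) s ζ (by rw [h4]; exact hm₀.flip)
      have h5 : P.mk ν φ ≫ P.ι δ = P.mk ν ζ := by rw [P.mk_comp_ι, hφ]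
      refine ⟨P.mk ν φ, ?_, h5⟩
      rw [← cancel_mono (P.ι δ), Category.assoc, Category.assoc, ← hsq]
      rw [h5]
      rw [← Category.assoc, hpb.w]

end Partialization

/-! ### The iterated partialization -/

/-- A small category to which the partialization can be applied again and again. -/
structure PCat : Type (u + 1) where
  carrier : Type u
  cat : SmallCategory carrier
  pullbacks : HasMonoPullbacks carrier
  complements : HasStrongComplements carrier

attribute [instance] PCat.cat PCat.pullbacks PCat.complements

/-- The partialization, as an operation on such categories. -/
noncomputable def PCat.next (S : PCat.{u}) : PCat.{u} :=
  ⟨P S.carrier, inferInstance, inferInstance, inferInstance⟩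

section Iterate

variable (C : Type u) [SmallCategory C] [InS C] [AllMono C]

/-- `PPow C n` is the iterated partialization `P (P (⋯ (P C)))` with `n` factors `P`, bundled. -/
noncomputable def PPow : ℕ → PCat.{u}
  | 0 => ⟨C, inferInstance, inferInstance, AllMono.hasStrongComplements C⟩
  | n + 1 => (PPow n).next

/-- The `n`-fold iterated partialization of `C`, a small category. -/
abbrev PIter (n : ℕ) : Type u := (PPow C n).carrier

variable {C}

/-- The object of the `n`-fold partialization that corresponds to the object `i` of `C`. -/
noncomputable def PIter.of : (n : ℕ) → C → PIter C n
  | 0, i => i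
  | n + 1, i => P.of (PIter.of n i)

/-- The canonical inclusion of `C` into its `n`-fold partialization, on morphisms. -/
noncomputable def PIter.ι : (n : ℕ) → {i j : C} → (i ⟶ j) → (PIter.of n i ⟶ PIter.of n j)
  | 0, _, _, f => f
  | n + 1, _, _, f => P.ι (PIter.ι n f)

instance PIter.mono_ι (n : ℕ) {i j : C} (f : i ⟶ j) [h : Mono f] : Mono (PIter.ι n f) := by
  induction n with
  | zero => exact h
  | succ n ih => exact P.mono_ι (PIter.ι n f)

end Iterate

section Chains

/-- `MonoChain n i k` is the type of chains of monomorphisms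
`i ↩ k_n ↩ k_{n-1} ↩ ⋯ ↩ k_1 = k` with `n` arrows `α_n, …, α_1`, beginning with the outermost
arrow `α_n : k_n ⟶ i`. The empty chain (`n = 0`) has `k = i`. -/
inductive MonoChain {C : Type u} [SmallCategory C] : ℕ → C → C → Type u
  | nil (i : C) : MonoChain 0 i i
  | cons {n : ℕ} {i l k : C} (α : l ⟶ i) (hα : Mono α) (c : MonoChain n l k) :
      MonoChain (n + 1) i k

/-- The composite `α_n ⋯ α_2 α_1 : k_1 ⟶ i` of a chain (the identity for the empty chain). -/
def MonoChain.composite {C : Type u} [SmallCategory C] :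
    {n : ℕ} → {i k : C} → MonoChain n i k → (k ⟶ i)
  | _, _, _, .nil i => 𝟙 i
  | _, _, _, .cons α _ c => c.composite ≫ α

variable {C : Type u} [SmallCategory C] [InS C] [AllMono C]

/-- The morphism `D(n, i, j, k_•, α_•, f)` of the `n`-fold partialization that is given by the
diagram `i ↩ k_n ↩ ⋯ ↩ k_1 ⟶ j`: for `n = 0` it is `f` itself, and for `n + 1` it is the class of
the diagram `i ↩ k_{n+1} ⟶ j` in the `n`-fold partialization, with left leg `α_{n+1}` and right
leg `D(n, k_{n+1}, j, k_•, α_•, f)`. -/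
noncomputable def D {j : C} :
    {n : ℕ} → {i k : C} → MonoChain n i k → (k ⟶ j) → (PIter.of n i ⟶ PIter.of n j)
  | 0, _, _, .nil _, f => f
  | n + 1, _, _, .cons α hα c, f =>
      haveI := hα
      P.mk (PIter.ι n α) (D c f)

theorem PIter.exists_of {n : ℕ} (x : PIter C n) : ∃ i : C, x = PIter.of n i := by
  induction n with
  | zero => exact ⟨x, rfl⟩
  | succ n ih =>
    obtain ⟨x⟩ := (x : P (PIter C n))
    obtain ⟨i, rfl⟩ := ih x
    exact ⟨i, rfl⟩

theorem PIter.exists_eq_ι_of_mono {n : ℕ} {i j : C} (x : PIter.of n i ⟶ PIter.of n j) [hx : Mono x] :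
    ∃ (f : i ⟶ j) (_ : Mono f), x = PIter.ι n f := by
  induction n with
  | zero => exact ⟨x, hx, rfl⟩
  | succ n ih =>
    have : @Mono (P (PIter C n)) _ (P.of (PIter.of n i)) (P.of (PIter.of n j)) x := hx
    obtain ⟨y, hy, hxy⟩ :=
      P.exists_eq_ι_of_mono (i := PIter.of n i) (j := PIter.of n j) x
    obtain ⟨f, hf, rfl⟩ := ih y
    exact ⟨f, hf, hxy⟩

/-- Every morphism of the `n`-fold partialization is given by such a diagram. -/
theorem exists_eq_D {n : ℕ} {i j : C} (x : PIter.of n i ⟶ PIter.of n j) :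
    ∃ (k : C) (c : MonoChain n i k) (f : k ⟶ j), x = D c f := by
  induction n generalizing i with
  | zero => exact ⟨i, .nil i, x, rfl⟩
  | succ n ih =>
    obtain ⟨l, a, ha, y, rfl⟩ := P.exists_rep (i := PIter.of n i) (j := PIter.of n j) x
    obtain ⟨l, rfl⟩ := PIter.exists_of l
    obtain ⟨α, hα, rfl⟩ := PIter.exists_eq_ι_of_mono a
    obtain ⟨k, c, f, rfl⟩ := ih y
    exact ⟨k, .cons α hα c, f, rfl⟩

end Chains

/-! ### Notions for semigroups -/

/-- `x : i ⟶ j` and `y : j ⟶ i` form a pair of inverse elements: `x y x = x` and `y x y = y`. -/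
def InversePair {E : Type u} [SmallCategory E] {i j : E} (x : i ⟶ j) (y : j ⟶ i) : Prop :=
  x ≫ y ≫ x = x ∧ y ≫ x ≫ y = y

/-- A monoid is regular if every `x` has some `y` with `x y x = x`. -/
def RegularMonoid (M : Type*) [Monoid M] : Prop := ∀ x : M, ∃ y : M, x * y * x = x

/-- A monoid is orthodox if it is regular and its idempotents form a subsemigroup. -/
def OrthodoxMonoid (M : Type*) [Monoid M] : Prop :=
  RegularMonoid M ∧
    ∀ e f : M, IsIdempotentElem e → IsIdempotentElem f → IsIdempotentElem (e * f)

/-- `M` is a retract of `N`: there are monoid homomorphisms `M → N → M` with composite the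
identity. -/
def MonoidRetract (M N : Type*) [Monoid M] [Monoid N] : Prop :=
  ∃ (s : M →* N) (r : N →* M), r.comp s = MonoidHom.id M

end Partialize

open Partialize

/-!
The iterated partializations are compared with the first one. In `P (P E)` a morphism is a class
`[ι α, x]`, and in `P E` the monomorphism `ι α` has the left inverse `[α, 1]`; sending `[ι α, x]`
to `[α, 1]` followed by `x` is compatible with composition (`P.contract_comp`), and it is a
retraction of `ι`. Iterating it yields multiplicative maps from `P^n(C)` to `P(C)` that send
`D c f` to `[c.composite, f]` (`exists_collapse`). Hence a pair of inverse elements or an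
idempotent of `P^n(C)` gives one in `P(C)`, where all morphisms of `C` being monic makes both
easy to determine.

For the converse direction, `D c f` factors as `D c 1` followed by the total morphism `f`, and
`D c 1` is a left inverse of the total morphism `c.composite`
(`D_id_comp_ι`, `ι_composite_comp_D_id`). All equations needed follow from these two identities.
In particular idempotency can be tested after applying the map to `P(C)`, where idempotents
commute, and this gives orthodoxy.
-/

namespace Partialize

/-! ### Contraction of the twofold partialization -/

section Contract

variable {E : Type u} [SmallCategory E] [HasMonoPullbacks E]

theorem P.mk_congr_iso {i j k k' : E} (e : k ≅ k') (α : k' ⟶ i) [Mono α] (f : k' ⟶ j)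
    (α' : k ⟶ i) [Mono α'] (f' : k ⟶ j) (h : e.hom ≫ α = α') (h' : e.hom ≫ f = f') :
    P.mk α' f' = P.mk α f :=
  (P.mk_eq_iff _ _ _ _).2 ⟨e, h, h'⟩

/-- The partial identity on a subobject fixes all partial morphisms whose domain is contained in
that subobject. -/
theorem P.mk_self_comp_mk {i j k l : E} (μ : k ⟶ i) [Mono μ] (w : l ⟶ k) [Mono (w ≫ μ)]
    (f : l ⟶ j) : P.mk μ μ ≫ P.mk (w ≫ μ) f = P.mk (w ≫ μ) f := by
  have : Mono w := mono_of_mono w μ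
  have hp : IsPullback w (𝟙 l) μ (w ≫ μ) :=
    isPullback_of_mono (by simp) fun u z h => ⟨z, by
      rw [← cancel_mono μ, Category.assoc, h]⟩
  rw [P.mk_comp_mk μ μ (w ≫ μ) f hp, Category.id_comp f]

/-- Restricting `[α, f]` to its domain gives the total morphism `f`. For `f = 1` this says that
`[α, 1]` is a left inverse of `ι α`. -/
theorem P.ι_comp_mk_self {i j k : E} (α : k ⟶ i) [Mono α] (f : k ⟶ j) :
    P.ι α ≫ P.mk α f = P.ι f := by
  have hp : IsPullback (𝟙 k) (𝟙 k) α α := ⟨⟨rfl⟩, ⟨PullbackCone.isLimitMkIdId α⟩⟩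
  rw [P.ι_comp_mk α α f hp, Category.id_comp f]
  rfl

theorem P.mk_id_comp_mk {i j k l : E} (α : k ⟶ i) [Mono α] (β : l ⟶ k) [Mono β]
    [Mono (β ≫ α)] (f : l ⟶ j) : P.mk α (𝟙 k) ≫ P.mk β f = P.mk (β ≫ α) f := by
  have hp : IsPullback β (𝟙 l) (𝟙 k) β := IsPullback.of_id_snd
  rw [P.mk_comp_mk α (𝟙 k) β f hp, Category.id_comp f]

/-- The canonical left inverse `[α, 1]` of a monomorphism `ι α` of the partialization. -/
noncomputable def P.leftInv {k i : P E} (a : k ⟶ i) [Mono a] : i ⟶ k :=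
  haveI := (P.exists_eq_ι_of_mono (i := k.as) (j := i.as) a).choose_spec.choose
  P.mk (P.exists_eq_ι_of_mono (i := k.as) (j := i.as) a).choose (𝟙 k.as)

theorem P.leftInv_ι {k i : E} (α : k ⟶ i) [Mono α] : P.leftInv (P.ι α) = P.mk α (𝟙 k) := by
  have h := P.exists_eq_ι_of_mono (P.ι α)
  have := h.choose_spec.choose
  have h2 : α = h.choose := P.ι_injective h.choose_spec.choose_spec
  exact (P.mk_eq_iff _ _ _ _).2 ⟨Iso.refl k, by simpa using h2, by simp⟩

theorem P.comp_leftInv {k i : P E} (a : k ⟶ i) [Mono a] : a ≫ P.leftInv a = 𝟙 k := by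
  obtain ⟨k⟩ := k
  obtain ⟨i⟩ := i
  obtain ⟨α, hα, rfl⟩ := P.exists_eq_ι_of_mono a
  rw [P.leftInv_ι, P.ι_comp_mk_self, P.ι_id]

theorem P.leftInv_comp {k l i : P E} (b : l ⟶ k) (a : k ⟶ i) [Mono b] [Mono a]
    [Mono (b ≫ a)] : P.leftInv (b ≫ a) = P.leftInv a ≫ P.leftInv b := by
  obtain ⟨k⟩ := k
  obtain ⟨i⟩ := i
  obtain ⟨l⟩ := l
  obtain ⟨α, hα, rfl⟩ := P.exists_eq_ι_of_mono a
  obtain ⟨β, hβ, rfl⟩ := P.exists_eq_ι_of_mono b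
  have : Mono (β ≫ α) := mono_comp _ _
  simp only [P.ι_comp]
  rw [P.leftInv_ι, P.leftInv_ι, P.leftInv_ι, P.mk_id_comp_mk]

theorem P.leftInv_iso {k i : P E} (e : k ≅ i) : P.leftInv e.hom = e.inv := by
  rw [← cancel_epi e.hom, P.comp_leftInv, e.hom_inv_id]

/-- Base change for left inverses of monomorphisms: this is what makes the contraction below
compatible with composition. -/
theorem P.leftInv_comp_of_isPullback {p k l j : P E} {a : p ⟶ k} {b : p ⟶ l} {x : k ⟶ j}
    {m : l ⟶ j} [Mono a] [Mono m] (h : IsPullback a b x m) :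
    P.leftInv a ≫ b = x ≫ P.leftInv m := by
  obtain ⟨p⟩ := p
  obtain ⟨k⟩ := k
  obtain ⟨l⟩ := l
  obtain ⟨j⟩ := j
  obtain ⟨α, hα, rfl⟩ := P.exists_eq_ι_of_mono a
  obtain ⟨β, hβ, rfl⟩ := P.exists_eq_ι_of_mono m
  obtain ⟨q, ξ, hξ, f, rfl⟩ := P.exists_rep x
  obtain ⟨s, σ, hσ, τ, rfl⟩ := P.exists_rep b
  obtain ⟨t, β', f', hβ', hp⟩ := exists_isPullback (C := E) f β
  have hμ : Mono (β' ≫ ξ) := mono_comp _ _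
  have hσα : Mono (σ ≫ α) := mono_comp _ _
  have hright : P.mk ξ f ≫ P.leftInv (P.ι β) = P.mk (β' ≫ ξ) f' := by
    rw [P.leftInv_ι, P.mk_comp_mk ξ f β (𝟙 l) hp, Category.comp_id f']
  have hleft : P.leftInv (P.ι α) ≫ P.mk σ τ = P.mk (σ ≫ α) τ := by
    rw [P.leftInv_ι, P.mk_id_comp_mk]
  -- The domain of the left-hand side is contained in the subobject `β' ≫ ξ`.
  obtain ⟨w, hw⟩ : ∃ w : s ⟶ t, w ≫ β' ≫ ξ = σ ≫ α := by
    obtain ⟨v, c, d, hc, hv⟩ := exists_isPullback (C := E) α ξ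
    have hsq := h.w
    rw [P.ι_comp_mk α ξ f hv, P.mk_comp_ι] at hsq
    obtain ⟨e, h1, h2⟩ := (P.mk_eq_iff _ _ _ _).1 hsq
    refine ⟨hp.lift (e.inv ≫ d) τ ?_, ?_⟩
    · rw [Category.assoc, ← h2, e.inv_hom_id_assoc]
    · rw [hp.lift_fst_assoc, Category.assoc, ← hv.w, ← h1, Category.assoc, e.inv_hom_id_assoc]
  -- The partial identity on `β' ≫ ξ` factors through the pullback.
  have hcone : P.mk (β' ≫ ξ) (β' ≫ ξ) ≫ P.mk ξ f = P.mk (β' ≫ ξ) f' ≫ P.ι β := by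
    have hq : IsPullback (𝟙 t) β' (β' ≫ ξ) ξ :=
      isPullback_of_mono (by simp) fun u _ _ => ⟨u, Category.comp_id u⟩
    have : Mono (𝟙 t ≫ β' ≫ ξ) := by simpa using hμ
    rw [P.mk_comp_mk (β' ≫ ξ) (β' ≫ ξ) ξ f hq, P.mk_comp_ι, ← hp.w]
    exact P.mk_congr_iso (Iso.refl t) _ _ _ _ (by simp) (by simp)
  have hfix : P.mk (β' ≫ ξ) (β' ≫ ξ) ≫ P.mk (σ ≫ α) τ = P.mk (σ ≫ α) τ := by
    have : Mono (w ≫ β' ≫ ξ) := by rw [hw]; exact hσα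
    have h1 := P.mk_self_comp_mk (β' ≫ ξ) w τ
    simpa only [hw] using h1
  calc P.leftInv (P.ι α) ≫ P.mk σ τ
      = P.mk (β' ≫ ξ) (β' ≫ ξ) ≫ P.leftInv (P.ι α) ≫ P.mk σ τ := by rw [hleft, hfix]
    _ = h.lift _ _ hcone ≫ (P.ι α ≫ P.leftInv (P.ι α)) ≫ P.mk σ τ := by
        conv_lhs => rw [← h.lift_fst _ _ hcone]
        simp only [Category.assoc]
    _ = P.mk (β' ≫ ξ) f' := by
        rw [P.comp_leftInv, Category.id_comp (P.mk σ τ), h.lift_snd]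
    _ = P.mk ξ f ≫ P.leftInv (P.ι β) := hright.symm

/-- The contraction `P (P E) → P E` on morphisms: `[ι α, x]` is sent to `[α, 1]` followed
by `x`. -/
noncomputable def P.contract [HasStrongComplements E] {i j : P E} (x : P.of i ⟶ P.of j) :
    i ⟶ j :=
  Quotient.lift (s := Diag.setoid i j)
    (fun d : Diag i j => haveI := d.mono; P.leftInv d.incl ≫ d.map) (by
      rintro ⟨k, a, ha, y⟩ ⟨k', a', ha', y'⟩ ⟨e, h1, h2⟩
      dsimp only at e h1 h2 ⊢
      subst h1 h2
      rw [P.leftInv_comp, P.leftInv_iso]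
      simp) x

variable [HasStrongComplements E]

theorem P.contract_mk {i j k : P E} (a : k ⟶ i) [Mono a] (x : k ⟶ j) :
    P.contract (P.mk a x) = P.leftInv a ≫ x := rfl

theorem P.contract_ι {i j : P E} (x : i ⟶ j) : P.contract (P.ι x) = x := by
  have h : P.leftInv (𝟙 i) = 𝟙 i := by
    rw [← Category.id_comp (P.leftInv (𝟙 i)), P.comp_leftInv]
  rw [P.ι, P.contract_mk, h, Category.id_comp]

theorem P.contract_comp {i j l : P E} (x : P.of i ⟶ P.of j) (y : P.of j ⟶ P.of l) :
    P.contract (x ≫ y) = P.contract x ≫ P.contract y := by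
  obtain ⟨k, a, ha, x, rfl⟩ := P.exists_rep x
  obtain ⟨k', b, hb, y, rfl⟩ := P.exists_rep y
  obtain ⟨p, c, d, hc, hp⟩ := exists_isPullback x b
  have : Mono (c ≫ a) := mono_comp _ _
  rw [P.mk_comp_mk a x b y hp, P.contract_mk, P.contract_mk, P.contract_mk, P.leftInv_comp]
  simp only [Category.assoc]
  rw [← Category.assoc x, ← P.leftInv_comp_of_isPullback hp, Category.assoc]

/-- The endomorphism monoids of a partialization are retracts of those of the next one. -/
theorem P.monoidRetract_end (i : P E) : MonoidRetract (End i) (End (P.of i)) :=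
  ⟨{ toFun := fun x => P.ι x
     map_one' := P.ι_id i
     map_mul' := fun x y => (P.ι_comp y x).symm },
   { toFun := fun x => P.contract x
     map_one' := P.contract_ι (𝟙 i)
     map_mul' := fun x y => P.contract_comp y x },
   MonoidHom.ext fun x => P.contract_ι x⟩

end Contract

/-! ### Partial morphisms with monic right legs -/

section AllMono

variable {C : Type u} [SmallCategory C] [HasMonoPullbacks C] [AllMono C]

/-- If `x y x = x` for partial monomorphisms `x = [α, f]` and `y`, then on the domain of `x` the
morphism `x` followed by `y` is the inclusion `α`. -/
theorem P.comp_eq_of_comp_comp_eq {i j k : C} (α : k ⟶ i) [Mono α] (f : k ⟶ j)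
    (y : P.of j ⟶ P.of i) (h : P.mk α f ≫ y ≫ P.mk α f = P.mk α f) :
    P.ι f ≫ y = P.ι α := by
  have h1 : P.ι f ≫ y ≫ P.mk α f = P.ι f := by
    have := congrArg (P.ι α ≫ ·) h
    simpa only [← Category.assoc, P.ι_comp_mk_self] using this
  rw [← Category.assoc] at h1
  obtain ⟨m, ρ, hρ, u, hu⟩ := P.exists_rep (P.ι f ≫ y)
  rw [hu] at h1 ⊢
  obtain ⟨p, a, b, ha, hp⟩ := exists_isPullback (C := C) u α
  have : Mono (a ≫ ρ) := mono_comp _ _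
  rw [P.mk_comp_mk ρ u α f hp] at h1
  obtain ⟨e, h2, h3⟩ := (P.mk_eq_iff _ _ (𝟙 k) f).1 h1
  have hf := AllMono.mono f
  rw [Category.comp_id] at h2
  have hb : b = e.hom := by rw [← cancel_mono f, h3]
  -- The monomorphism `ρ` is split epi, as `a ≫ ρ` is an isomorphism.
  have h4 : (e.inv ≫ a) ≫ ρ = 𝟙 k := by rw [Category.assoc, ← h2, e.inv_hom_id]
  have h5 : ρ ≫ e.inv ≫ a = 𝟙 m := by
    rw [← cancel_mono ρ, Category.assoc, h4, Category.comp_id, Category.id_comp]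
  refine P.mk_congr_iso ⟨ρ, e.inv ≫ a, h5, h4⟩ _ _ _ _ (Category.comp_id ρ) ?_
  have h6 : (e.inv ≫ a) ≫ u = α := by
    rw [Category.assoc, hp.w, hb, e.inv_hom_id_assoc]
  calc ρ ≫ α = (ρ ≫ e.inv ≫ a) ≫ u := by rw [← h6]; simp only [Category.assoc]
    _ = u := by rw [h5, Category.id_comp]

/-- A pair of inverse partial monomorphisms: each is the converse of the other. -/
theorem P.exists_iso_of_inversePair {i j k l : C} (α : k ⟶ i) [Mono α] (f : k ⟶ j) (β : l ⟶ j)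
    [Mono β] (g : l ⟶ i) (h : InversePair (P.mk α f) (P.mk β g)) :
    ∃ γ : k ≅ l, α = γ.hom ≫ g ∧ f = γ.hom ≫ β := by
  -- Each of the two equations shows that one domain is mapped into the other one.
  have key : ∀ {i j k l : C} (α : k ⟶ i) [Mono α] (f : k ⟶ j) (β : l ⟶ j) [Mono β] (g : l ⟶ i),
      P.mk α f ≫ P.mk β g ≫ P.mk α f = P.mk α f →
        ∃ c : k ⟶ l, α = c ≫ g ∧ f = c ≫ β := by
    intro i j k l α _ f β _ g h
    have h1 := P.comp_eq_of_comp_comp_eq α f _ h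
    obtain ⟨p, a, b, ha, hp⟩ := exists_isPullback (C := C) f β
    rw [P.ι_comp_mk f β g hp] at h1
    obtain ⟨e, h2, h3⟩ := (P.mk_eq_iff _ _ (𝟙 k) α).1 h1
    rw [Category.comp_id] at h2
    refine ⟨e.inv ≫ b, ?_, ?_⟩
    · rw [Category.assoc, ← h3, e.inv_hom_id_assoc]
    · rw [Category.assoc, ← hp.w, ← h2, e.inv_hom_id_assoc]
  obtain ⟨c, hc, hc'⟩ := key α f β g h.1
  obtain ⟨d, hd, hd'⟩ := key β g α f h.2
  refine ⟨⟨c, d, ?_, ?_⟩, hc, hc'⟩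
  · rw [← cancel_mono α, Category.assoc, ← hd', ← hc, Category.id_comp]
  · rw [← cancel_mono β, Category.assoc, ← hc', ← hd, Category.id_comp]

theorem P.eq_of_idempotent {i k : C} (α : k ⟶ i) [Mono α] (f : k ⟶ i)
    (h : P.mk α f ≫ P.mk α f = P.mk α f) : f = α := by
  have h1 := P.comp_eq_of_comp_comp_eq α f (P.mk α f) (by rw [h, h])
  have h3 : P.mk α α = P.mk α f := by
    have h4 := congrArg (P.mk α (𝟙 k) ≫ ·) h1
    simp only [← Category.assoc, P.mk_comp_ι, Category.id_comp f, Category.id_comp α] at h4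
    rw [← h4, h]
  have h5 := congrArg (P.ι α ≫ ·) h3
  simp only [P.ι_comp_mk_self] at h5
  exact (P.ι_injective h5).symm

/-- The idempotents are the partial identities on subobjects, and the composite of two of these is
the partial identity on the intersection. -/
theorem P.idempotent_comp {i : C} (x y : P.of i ⟶ P.of i) (hx : x ≫ x = x) (hy : y ≫ y = y) :
    (x ≫ y) ≫ x ≫ y = x ≫ y := by
  obtain ⟨k, α, hα, f, rfl⟩ := P.exists_rep x
  obtain ⟨l, β, hβ, g, rfl⟩ := P.exists_rep y
  obtain rfl := P.eq_of_idempotent _ _ hx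
  obtain rfl := P.eq_of_idempotent _ _ hy
  obtain ⟨p, a, b, ha, hp⟩ := exists_isPullback (C := C) f g
  have hm : Mono (a ≫ f) := mono_comp _ _
  rw [P.mk_comp_mk f f g g hp]
  simp only [← hp.w]
  have : Mono (𝟙 p ≫ a ≫ f) := by simpa using hm
  simpa using P.mk_self_comp_mk (a ≫ f) (𝟙 p) (a ≫ f)

end AllMono

/-! ### Diagrams in the iterated partialization -/

section Chains

variable {C : Type u} [SmallCategory C]

theorem MonoChain.mono_composite [AllMono C] {n : ℕ} {i k : C} (c : MonoChain n i k) :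
    Mono c.composite :=
  AllMono.mono _

/-- Every monomorphism is the composite of a chain of any positive length. -/
theorem MonoChain.exists_composite_eq (n : ℕ) {j k : C} (f : k ⟶ j) (hf : Mono f) :
    ∃ c : MonoChain (n + 1) j k, c.composite = f := by
  have h : ∀ n : ℕ, ∃ c : MonoChain n k k, c.composite = 𝟙 k := by
    intro n
    induction n with
    | zero => exact ⟨.nil k, rfl⟩
    | succ n ih =>
      obtain ⟨c, hc⟩ := ih
      exact ⟨.cons (𝟙 k) inferInstance c, by simp [MonoChain.composite, hc]⟩
  obtain ⟨c, hc⟩ := h n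
  exact ⟨.cons f hf c, by simp [MonoChain.composite, hc]⟩

variable [InS C] [AllMono C]

theorem PIter.ι_comp (n : ℕ) {i j k : C} (f : i ⟶ j) (g : j ⟶ k) :
    PIter.ι n f ≫ PIter.ι n g = PIter.ι n (f ≫ g) := by
  induction n with
  | zero => rfl
  | succ n ih => exact (P.ι_comp (PIter.ι n f) (PIter.ι n g)).trans (congrArg P.ι ih)

theorem PIter.ι_id (n : ℕ) (i : C) : PIter.ι n (𝟙 i) = 𝟙 (PIter.of n i) := by
  induction n with
  | zero => rfl
  | succ n ih => exact (congrArg P.ι ih).trans (P.ι_id _)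

theorem D_comp_ι {n : ℕ} {i j k m : C} (c : MonoChain n i k) (f : k ⟶ j) (g : j ⟶ m) :
    D c f ≫ PIter.ι n g = D c (f ≫ g) := by
  induction c with
  | nil i => rfl
  | @cons n i l k α hα c ih =>
    exact (P.mk_comp_ι (PIter.ι n α) (D c f) (PIter.ι n g)).trans
      (congrArg (P.mk (PIter.ι n α)) (ih f))

theorem D_id_comp_ι {n : ℕ} {i j k : C} (c : MonoChain n i k) (f : k ⟶ j) :
    D c (𝟙 k) ≫ PIter.ι n f = D c f := by
  rw [D_comp_ι, Category.id_comp]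

/-- The morphism `D c 1` is a left inverse of the total morphism given by the composite of the
chain `c`. -/
theorem ι_composite_comp_D_id {n : ℕ} {i k : C} (c : MonoChain n i k) :
    PIter.ι n c.composite ≫ D c (𝟙 k) = 𝟙 (PIter.of n k) := by
  induction c with
  | nil i => exact Category.id_comp (𝟙 i)
  | @cons n i l k α hα c ih =>
    have h : PIter.ι (n + 1) α ≫ D (.cons α hα c) (𝟙 k) = P.ι (D c (𝟙 k)) :=
      P.ι_comp_mk_self (PIter.ι n α) (D c (𝟙 k))
    rw [MonoChain.composite, ← PIter.ι_comp, Category.assoc, h]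
    exact (P.ι_comp (PIter.ι n c.composite) (D c (𝟙 k))).trans
      ((congrArg P.ι ih).trans (P.ι_id _))

/-- The composite of the chain `c` cancels against the left inverse `D c 1` contained in `D c f`. -/
theorem D_composite_comp_D {n : ℕ} {i j k m l : C} (c : MonoChain n i k) (f : k ⟶ j)
    (β : MonoChain n m l) (g : l ⟶ k) :
    D β (g ≫ c.composite) ≫ D c f = D β (g ≫ f) := by
  rw [← D_comp_ι β g, ← D_id_comp_ι c f, Category.assoc,
    ← Category.assoc (PIter.ι n c.composite), ι_composite_comp_D_id, Category.id_comp, D_comp_ι]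

theorem inversePair_D {n : ℕ} {i j k l : C} (α : MonoChain n i k) (f : k ⟶ j)
    (β : MonoChain n j l) (g : l ⟶ i) (γ : k ≅ l) (h1 : α.composite = γ.hom ≫ g)
    (h2 : f = γ.hom ≫ β.composite) : InversePair (D α f) (D β g) := by
  have h3 : g = γ.inv ≫ α.composite := by rw [h1, γ.inv_hom_id_assoc]
  subst h2
  rw [h3]
  constructor
  · rw [D_composite_comp_D, D_composite_comp_D, γ.inv_hom_id_assoc]
  · rw [D_composite_comp_D, D_composite_comp_D, γ.hom_inv_id_assoc]

theorem D_composite_idempotent {n : ℕ} {i k : C} (c : MonoChain n i k) :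
    D c c.composite ≫ D c c.composite = D c c.composite := by
  simpa using D_composite_comp_D c c.composite c (𝟙 k)

/-- There are multiplicative maps from the `n`-fold partialization to the partialization that
compose the arrows of the chain of a diagram. For `n = 0` this is the canonical inclusion. -/
theorem exists_collapse (C : Type u) [SmallCategory C] [InS C] [AllMono C] (n : ℕ) :
    ∃ π : ∀ {i j : C}, (PIter.of n i ⟶ PIter.of n j) → (P.of i ⟶ P.of j),
      (∀ {i j k : C} (x : PIter.of n i ⟶ PIter.of n j) (y : PIter.of n j ⟶ PIter.of n k),
        π (x ≫ y) = π x ≫ π y) ∧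
      ∀ {i j k : C} (c : MonoChain n i k) (f : k ⟶ j),
        haveI := c.mono_composite
        π (D c f) = P.mk c.composite f := by
  cases n with
  | zero =>
    refine ⟨fun x => P.ι x, fun x y => (P.ι_comp x y).symm, fun c f => ?_⟩
    cases c
    rfl
  | succ n =>
    induction n with
    | zero =>
      refine ⟨fun x => x, fun x y => rfl, fun c f => ?_⟩
      cases c with
      | cons α hα c =>
        cases c
        have : Mono (𝟙 _ ≫ α) := AllMono.mono _
        have h : P.mk α f = P.mk (𝟙 _ ≫ α) f :=
          P.mk_congr_iso (Iso.refl _) _ _ _ _ (by simp) (by simp)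
        exact h
    | succ n ih =>
      obtain ⟨π, hπ, hD⟩ := ih
      refine ⟨fun {i j} x => π (P.contract (E := PIter C n) (i := PIter.of (n + 1) i)
        (j := PIter.of (n + 1) j) x), fun x y => ?_, fun c f => ?_⟩
      · exact (congrArg π (P.contract_comp (E := PIter C n) x y)).trans (hπ _ _)
      · cases c with
        | cons α hα c =>
        cases c with
        | cons β hβ c =>
          have hβα : Mono (β ≫ α) := mono_comp _ _
          -- Contraction composes the two outermost arrows of the chain.
          have h : P.contract (E := PIter C n) (D (.cons α hα (.cons β hβ c)) f) =
              D (.cons (β ≫ α) hβα c) f := by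
            have : Mono (PIter.ι n β ≫ PIter.ι n α) := mono_comp _ _
            refine (P.contract_mk (E := PIter C n) (P.ι (PIter.ι n α)) _).trans ?_
            rw [P.leftInv_ι]
            refine (P.mk_id_comp_mk (PIter.ι n α) (PIter.ι n β) (D c f)).trans ?_
            simp only [PIter.ι_comp]
            rfl
          refine (congrArg π h).trans ((hD _ f).trans ?_)
          simp only [MonoChain.composite, Category.assoc]

theorem eq_composite_of_idempotent {n : ℕ} {i k : C} (c : MonoChain n i k) (f : k ⟶ i)
    (h : D c f ≫ D c f = D c f) : f = c.composite := by
  obtain ⟨π, hπ, hD⟩ := exists_collapse C n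
  have := c.mono_composite
  refine P.eq_of_idempotent c.composite f ?_
  rw [← hD, ← hπ, h]

theorem exists_iso_of_inversePair_D {n : ℕ} {i j k l : C} (α : MonoChain n i k) (f : k ⟶ j)
    (β : MonoChain n j l) (g : l ⟶ i) (h : InversePair (D α f) (D β g)) :
    ∃ γ : k ≅ l, α.composite = γ.hom ≫ g ∧ f = γ.hom ≫ β.composite := by
  obtain ⟨π, hπ, hD⟩ := exists_collapse C n
  have := α.mono_composite
  have := β.mono_composite
  refine P.exists_iso_of_inversePair α.composite f β.composite g ⟨?_, ?_⟩
  · rw [← hD α f, ← hD β g, ← hπ, ← hπ, h.1]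
  · rw [← hD α f, ← hD β g, ← hπ, ← hπ, h.2]

theorem regularMonoid_end (n : ℕ) (i : C) : RegularMonoid (End (PIter.of (n + 1) i)) := by
  intro x
  obtain ⟨k, c, f, rfl⟩ := exists_eq_D x
  obtain ⟨d, hd⟩ := MonoChain.exists_composite_eq n f (AllMono.mono f)
  exact ⟨D d c.composite,
    (inversePair_D c f d c.composite (Iso.refl k) (by simp) (by simp [hd])).1⟩

/-- A morphism is idempotent as soon as its image in `P(C)` is, and idempotents of `P(C)` are
closed under composition. -/
theorem idempotent_comp {n : ℕ} {i : C} (x y : PIter.of n i ⟶ PIter.of n i)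
    (hx : x ≫ x = x) (hy : y ≫ y = y) : (x ≫ y) ≫ x ≫ y = x ≫ y := by
  obtain ⟨π, hπ, hD⟩ := exists_collapse C n
  have h := P.idempotent_comp (π x) (π y) (by rw [← hπ, hx]) (by rw [← hπ, hy])
  rw [← hπ] at h
  obtain ⟨k, c, f, hxy⟩ := exists_eq_D (x ≫ y)
  have := c.mono_composite
  rw [hxy] at h ⊢
  rw [hD] at h
  rw [P.eq_of_idempotent _ _ h, D_composite_idempotent]

end Chains

end Partialize

theorem mainTheorem2 (C : Type u) [SmallCategory C] [InS C] [AllMono C] :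
    -- (i) pairs of inverse elements
    (∀ (n : ℕ) (i j k l : C) (α : MonoChain n i k) (f : k ⟶ j) (β : MonoChain n j l)
        (g : l ⟶ i),
      InversePair (D α f) (D β g) ↔
        ∃ γ : k ≅ l, α.composite = γ.hom ≫ g ∧ f = γ.hom ≫ β.composite) ∧
    -- (ii) regularity and retracts
    (∀ (k : ℕ), 1 ≤ k → ∀ i : C,
      RegularMonoid (End (PIter.of k i)) ∧
        MonoidRetract (End (PIter.of k i)) (End (PIter.of (k + 1) i))) ∧
    -- (iii) idempotents
    (∀ (n : ℕ) (i k : C) (α : MonoChain n i k) (f : k ⟶ i),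
      D α f ≫ D α f = D α f ↔ f = α.composite) ∧
    -- (iv) orthodoxy
    (∀ (k : ℕ), 1 ≤ k → ∀ i : C, OrthodoxMonoid (End (PIter.of k i))) := by 
  refine ⟨fun n i j k l α f β g => ⟨exists_iso_of_inversePair_D α f β g, ?_⟩, fun k hk i => ?_,
    fun n i k α f => ⟨eq_composite_of_idempotent α f, ?_⟩, fun k hk i => ?_⟩
  · rintro ⟨γ, h1, h2⟩
    exact inversePair_D α f β g γ h1 h2
  · obtain ⟨n, rfl⟩ := Nat.exists_eq_succ_of_ne_zero (Nat.one_le_iff_ne_zero.1 hk)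
    exact ⟨regularMonoid_end n i, P.monoidRetract_end (E := PIter C n) (PIter.of (n + 1) i)⟩
  · rintro rfl
    exact D_composite_idempotent α
  · obtain ⟨n, rfl⟩ := Nat.exists_eq_succ_of_ne_zero (Nat.one_le_iff_ne_zero.1 hk)
    exact ⟨regularMonoid_end n i, fun e f he hf => idempotent_comp f e hf he⟩
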